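/- Let $S$ be a discrete semigroup. For a bounded function $f\colon S\to\mathbb{C}$ and $s\in S$ let $(\ell_s f)(t)=f(st)$ $(t\in S)$, and let $WAP(S)$ be the subspace of those $f\in\ell^\infty(S)$ whose left orbit $\{\ell_s f : s\in S\}$ is relatively compact in the weak topology of $\ell^\infty(S)$. Suppose that $WAP(S)$ has a left invariant mean, that is, there is $m\in WAP(S)^*$ with $\|m\|=m(1)=1$ and $m(\ell_s f)=m(f)$ for all $s\in S$ and $f\in WAP(S)$. Let $X$ be a real or complex Banach space that is L-embedded: identifying $X$ with its canonical image in $X^{**}$, there is a subspace $X_s$ of $X^{**}$ such that $X^{**}=X\oplus_1 X_s$, i.e. $X^{**}=X\oplus X_s$ and $\|x+\xi\|=\|x\|+\|\xi\|$ for all $x\in X$, $\xi\in X_s$. Let $\{T_s : s\in S\}$ be a representation of $S$ on $X$ by nonexpansive affine mappings, that is, maps $T_s\colon X\to X$ such that $T_{st}x=T_s(T_t x)$, $\|T_s x-T_s y\|\le\|x-y\|$, and $T_s(ax+by)=aT_s x+bT_s y$ for all $s,t\in S$, all $x,y\in X$ and all real $a,b\ge 0$ with $a+b=1$. Suppose that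 there is a nonempty bounded set $B\subset X$ such that $B\subseteq\overline{T_s(B)}$ (norm closure) for every $s\in S$. Then $X$ contains a common fixed point for $S$: there is $x\in X$ with $T_s x=x$ for all $s\in S$. -/

import Mathlib

open scoped BoundedContinuousFunction

noncomputable section

/-- The left translate `ℓ_s f` of a bounded function `f` on a discrete semigroup `S`:
`(ℓ_s f)(t) = f (s t)`. For discrete `S`, the space `S →ᵇ ℂ` of bounded (continuous) functions with
the supremum norm is `ℓ^∞(S)`. -/
def leftTranslate {S : Type*} [Semigroup S] [TopologicalSpace S] [DiscreteTopology S]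
    (s : S) (f : S →ᵇ ℂ) : S →ᵇ ℂ :=
  f.compContinuous ⟨fun t => s * t, continuous_of_discreteTopology⟩

@[simp]
theorem leftTranslate_apply {S : Type*} [Semigroup S] [TopologicalSpace S] [DiscreteTopology S]
    (s : S) (f : S →ᵇ ℂ) (t : S) : leftTranslate s f t = f (s * t) := rfl

/-- The left orbit `{ℓ_s f : s ∈ S}` of `f`. -/
def leftOrbit {S : Type*} [Semigroup S] [TopologicalSpace S] [DiscreteTopology S]
    (f : S →ᵇ ℂ) : Set (S →ᵇ ℂ) :=
  Set.range fun s : S => leftTranslate s f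

/-- `f ∈ ℓ^∞(S)` is weakly almost periodic if its left orbit is relatively compact in the weak
topology of `ℓ^∞(S)`. -/
def IsWAP {S : Type*} [Semigroup S] [TopologicalSpace S] [DiscreteTopology S]
    (f : S →ᵇ ℂ) : Prop :=
  IsCompact (closure (toWeakSpace ℂ (S →ᵇ ℂ) '' leftOrbit f))

theorem IsWAP.of_subset {S : Type*} [Semigroup S] [TopologicalSpace S] [DiscreteTopology S]
    {f : S →ᵇ ℂ} {K : Set (WeakSpace ℂ (S →ᵇ ℂ))} (hK : IsCompact K)
    (h : ∀ s : S, toWeakSpace ℂ (S →ᵇ ℂ) (leftTranslate s f) ∈ K) : IsWAP f := by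
  apply hK.closure_of_subset
  rintro _ ⟨_, ⟨s, rfl⟩, rfl⟩
  exact h s

theorem IsWAP.mem_closure {S : Type*} [Semigroup S] [TopologicalSpace S] [DiscreteTopology S]
    (f : S →ᵇ ℂ) (s : S) : toWeakSpace ℂ (S →ᵇ ℂ) (leftTranslate s f) ∈
      closure (toWeakSpace ℂ (S →ᵇ ℂ) '' leftOrbit f) :=
  subset_closure ⟨_, ⟨s, rfl⟩, rfl⟩

theorem isWAP_const {S : Type*} [Semigroup S] [TopologicalSpace S] [DiscreteTopology S]
    (c : ℂ) : IsWAP (BoundedContinuousFunction.const S c) :=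
  IsWAP.of_subset
    (isCompact_singleton (x := toWeakSpace ℂ (S →ᵇ ℂ) (BoundedContinuousFunction.const S c)))
    fun _ => rfl

/-- `WAP(S)`, the space of weakly almost periodic functions, as a subspace of `ℓ^∞(S)`
(hence normed by the supremum norm). -/
def WAP (S : Type*) [Semigroup S] [TopologicalSpace S] [DiscreteTopology S] :
    Submodule ℂ (S →ᵇ ℂ) where
  carrier := {f | IsWAP f}
  zero_mem' := isWAP_const 0
  add_mem' := by
    intro f g hf hg
    refine IsWAP.of_subset (IsCompact.add hf hg) fun s => ?_
    exact Set.add_mem_add (IsWAP.mem_closure f s) (IsWAP.mem_closure g s)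
  smul_mem' := by
    intro c f hf
    refine IsWAP.of_subset (IsCompact.image hf (continuous_const_smul c)) fun s => ?_
    exact ⟨_, IsWAP.mem_closure f s, rfl⟩

/-- The constant function `1`, as an element of `WAP(S)`. -/
def WAP.one (S : Type*) [Semigroup S] [TopologicalSpace S] [DiscreteTopology S] : WAP S :=
  ⟨BoundedContinuousFunction.const S 1, isWAP_const 1⟩

/-- `WAP(S)` is invariant under left translations. -/
def WAP.translate {S : Type*} [Semigroup S] [TopologicalSpace S] [DiscreteTopology S]
    (s : S) (f : WAP S) : WAP S :=
  ⟨leftTranslate s (f : S →ᵇ ℂ), by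
    refine IsWAP.of_subset f.2 fun t => ?_
    have h : leftTranslate t (leftTranslate s (f : S →ᵇ ℂ)) = leftTranslate (s * t) f := by
      ext u
      simp [mul_assoc]
    rw [h]
    exact IsWAP.mem_closure _ _⟩

/-- `m ∈ WAP(S)^*` is a left invariant mean: `‖m‖ = m(1) = 1` and `m(ℓ_s f) = m(f)` for all
`s ∈ S` and `f ∈ WAP(S)`. -/
structure IsLeftInvariantMean {S : Type*} [Semigroup S] [TopologicalSpace S] [DiscreteTopology S]
    (m : StrongDual ℂ (WAP S)) : Prop where
  norm_eq_one : ‖m‖ = 1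
  map_one : m (WAP.one S) = 1
  map_translate : ∀ (s : S) (f : WAP S), m (WAP.translate s f) = m f

/-- `X` is L-embedded: the canonical image of `X` in `X^{**}` is an `ℓ₁`-summand, that is,
`X^{**} = X ⊕₁ X_s` for some subspace `X_s` of `X^{**}`. -/
def IsLEmbedded (𝕜 X : Type*) [RCLike 𝕜] [NormedAddCommGroup X] [NormedSpace 𝕜 X] : Prop :=
  ∃ Xs : Submodule 𝕜 (StrongDual 𝕜 (StrongDual 𝕜 X)),
    IsCompl (LinearMap.range (NormedSpace.inclusionInDoubleDual 𝕜 X).toLinearMap) Xs ∧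
    ∀ (x : X), ∀ ξ ∈ Xs,
      ‖NormedSpace.inclusionInDoubleDual 𝕜 X x + ξ‖ =
        ‖NormedSpace.inclusionInDoubleDual 𝕜 X x‖ + ‖ξ‖

/-- `{T_s : s ∈ S}` is a representation of `S` on the whole space `X` as nonexpansive affine
mappings. -/
structure IsNonexpansiveAffineRep (𝕜 : Type*) {S X : Type*} [RCLike 𝕜] [Semigroup S]
    [NormedAddCommGroup X] [NormedSpace 𝕜 X] (T : S → X → X) : Prop where
  map_mul : ∀ (s t : S) (x : X), T (s * t) x = T s (T t x)
  nonexpansive : ∀ (s : S) (x y : X), ‖T s x - T s y‖ ≤ ‖x - y‖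
  affine : ∀ (s : S) (a b : ℝ) (x y : X), 0 ≤ a → 0 ≤ b → a + b = 1 →
    T s ((a : 𝕜) • x + (b : 𝕜) • y) = (a : 𝕜) • T s x + (b : 𝕜) • T s y

end

open NormedSpace Metric
open scoped Pointwise

/-! The Chebyshev center `C` of `B` (the points attaining the least radius of a ball containing `B`)
is nonempty, convex and invariant under every `T s`. L-embeddedness makes it weakly compact: in
`X**` the corresponding set is weak-* compact, and a singular component of one of its points could
be dropped to reduce the radius.

For `x₀ ∈ C`, the functions `t ↦ ψ (T t x₀)` are weakly almost periodic. Writing `T s = L + T s 0`,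
their left translates come from the functionals `ψ ∘ L` plus constants, hence from a weak-* compact
set of parameters. The parametrization is weak-*-to-weak continuous because weak compactness of `C`
represents functionals on `ℓ^∞(S)`, pulled back to `X*`, by points of `X`. Applied to the invariant
mean, the same representation yields its barycenter `z`, and invariance says `ψ (T s z) = ψ z` for
all `ψ`. -/

/-- The canonical image of `x` in the bidual with its weak-* topology. -/
noncomputable def toWeakBidual (𝕜 : Type*) {X : Type*} [RCLike 𝕜] [NormedAddCommGroup X] [NormedSpace 𝕜 X]
    (x : X) : WeakDual 𝕜 (StrongDual 𝕜 X) :=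
  StrongDual.toWeakDual (inclusionInDoubleDual 𝕜 X x)

/-! ### Chebyshev centers in L-embedded spaces -/

section Chebyshev

variable {𝕜 X : Type*} [RCLike 𝕜] [NormedAddCommGroup X] [NormedSpace 𝕜 X]

/-- The points of `X` whose distance to every point of `B` is at most `r`. -/
def farthestBall (B : Set X) (r : ℝ) : Set X := {x | ∀ b ∈ B, ‖x - b‖ ≤ r}

/-- The analogue of `farthestBall` in the bidual, for the canonical image of `B`. -/
def bidualFarthestBall (𝕜 : Type*) {X : Type*} [RCLike 𝕜] [NormedAddCommGroup X] [NormedSpace 𝕜 X]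
    (B : Set X) (r : ℝ) : Set (WeakDual 𝕜 (StrongDual 𝕜 X)) :=
  ⋂ b ∈ B, WeakDual.toStrongDual ⁻¹' closedBall (inclusionInDoubleDual 𝕜 X b) r

theorem mem_bidualFarthestBall {B : Set X} {r : ℝ} {ξ : WeakDual 𝕜 (StrongDual 𝕜 X)} :
    ξ ∈ bidualFarthestBall 𝕜 B r ↔
      ∀ b ∈ B, ‖WeakDual.toStrongDual ξ - inclusionInDoubleDual 𝕜 X b‖ ≤ r := by
  rw [bidualFarthestBall, Set.mem_iInter₂]
  refine forall₂_congr fun b _ => ?_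
  exact mem_closedBall_iff_norm (b := WeakDual.toStrongDual ξ)
    (a := inclusionInDoubleDual 𝕜 X b) (r := r)

theorem isClosed_bidualFarthestBall (B : Set X) (r : ℝ) :
    IsClosed (bidualFarthestBall 𝕜 B r) :=
  isClosed_biInter fun _ _ => WeakDual.isClosed_closedBall _ _

theorem isCompact_bidualFarthestBall {B : Set X} (hB : B.Nonempty) (r : ℝ) :
    IsCompact (bidualFarthestBall 𝕜 B r) := by
  obtain ⟨b, hb⟩ := hB
  exact (WeakDual.isCompact_closedBall (inclusionInDoubleDual 𝕜 X b) r).of_isClosed_subset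
    (isClosed_bidualFarthestBall B r) (Set.biInter_subset_of_mem hb)

theorem toWeakBidual_mem_bidualFarthestBall {B : Set X} {r : ℝ} {x : X} :
    toWeakBidual 𝕜 x ∈ bidualFarthestBall 𝕜 B r ↔ x ∈ farthestBall B r := by
  have h (b : X) : ‖inclusionInDoubleDual 𝕜 X x - inclusionInDoubleDual 𝕜 X b‖ = ‖x - b‖ := by
    rw [← (inclusionInDoubleDualLi (E := X) 𝕜).norm_map (x - b)]
    exact congrArg norm (map_sub (inclusionInDoubleDual 𝕜 X) x b).symm
  rw [mem_bidualFarthestBall]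
  exact forall₂_congr fun b _ => by rw [← h b]; rfl

/-- In an L-embedded space the Chebyshev center of a bounded set is nonempty and weakly compact. -/
theorem IsLEmbedded.exists_chebyshev_center (hX : IsLEmbedded 𝕜 X) {B : Set X}
    (hBne : B.Nonempty) (hBb : Bornology.IsBounded B) :
    ∃ r : ℝ, (farthestBall B r).Nonempty ∧ IsCompact (toWeakBidual 𝕜 '' farthestBall B r) := by
  let R : Set ℝ := {ρ | (farthestBall B ρ).Nonempty}
  have hRpos : ∀ ρ ∈ R, 0 ≤ ρ := by
    rintro ρ ⟨x, hx⟩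
    obtain ⟨b, hb⟩ := hBne
    exact (norm_nonneg _).trans (hx b hb)
  have hRbdd : BddBelow R := ⟨0, hRpos⟩
  have hRne : R.Nonempty := by
    obtain ⟨M, hM⟩ := hBb.exists_norm_le
    exact ⟨M, 0, fun b hb => by simpa using hM b hb⟩
  have hsub : bidualFarthestBall 𝕜 B (sInf R) ⊆ Set.range (toWeakBidual 𝕜) := by
    intro ξ hξ
    obtain ⟨Xs, hc, hn⟩ := hX
    obtain ⟨y, hy, σ, hσ, hsum⟩ : ∃ y ∈ LinearMap.range
        (inclusionInDoubleDual 𝕜 X).toLinearMap, ∃ σ ∈ Xs, y + σ = WeakDual.toStrongDual ξ :=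
      Submodule.mem_sup.1 (by rw [hc.sup_eq_top]; trivial)
    obtain ⟨x, rfl⟩ := hy
    -- The ℓ₁-norm gives `‖x - b‖ + ‖σ‖ ≤ sInf R` for all `b ∈ B`, so a nonzero `σ` would contradict
    -- minimality.
    have hxR : sInf R - ‖σ‖ ∈ R := by
      refine ⟨x, fun b hb => ?_⟩
      have h1 := mem_bidualFarthestBall.1 hξ b hb
      rw [← hsum] at h1
      have h2 := hn (x - b) σ hσ
      have h3 : ‖inclusionInDoubleDual 𝕜 X (x - b)‖ = ‖x - b‖ :=
        (inclusionInDoubleDualLi 𝕜).norm_map (x - b)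
      rw [h3, map_sub] at h2
      have h4 : inclusionInDoubleDual 𝕜 X x - inclusionInDoubleDual 𝕜 X b + σ =
          (inclusionInDoubleDual 𝕜 X).toLinearMap x + σ - inclusionInDoubleDual 𝕜 X b := by
        simp only [ContinuousLinearMap.coe_coe]
        abel
      rw [h4] at h2
      linarith
    have hσ0 : σ = 0 := by
      have := csInf_le hRbdd hxR
      have h0 := norm_nonneg σ
      have h1 : ‖σ‖ = 0 := le_antisymm (by linarith) h0
      exact (norm_eq_zero (a := σ)).1 h1
    refine ⟨x, ?_⟩
    rw [hσ0, add_zero] at hsum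
    exact hsum
  have himage : toWeakBidual 𝕜 '' farthestBall B (sInf R) = bidualFarthestBall 𝕜 B (sInf R) := by
    ext ξ
    constructor
    · rintro ⟨x, hx, rfl⟩
      exact toWeakBidual_mem_bidualFarthestBall.2 hx
    · intro hξ
      obtain ⟨x, rfl⟩ := hsub hξ
      exact ⟨x, toWeakBidual_mem_bidualFarthestBall.1 hξ, rfl⟩
  refine ⟨sInf R, ?_, himage ▸ isCompact_bidualFarthestBall hBne _⟩
  rw [← Set.image_nonempty (f := toWeakBidual 𝕜), himage]
  have hmono : ∀ {ρ ρ' : ℝ}, ρ ≤ ρ' → bidualFarthestBall 𝕜 B ρ ⊆ bidualFarthestBall 𝕜 B ρ' :=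
    fun h ξ hξ => mem_bidualFarthestBall.2 fun b hb => (mem_bidualFarthestBall.1 hξ b hb).trans h
  -- The infimum is attained in the bidual, by compactness of the nested sets; `hsub` brings the
  -- point back to `X`.
  have hne : (⋂ ρ : R, bidualFarthestBall 𝕜 B ρ).Nonempty := by
    have : Nonempty R := hRne.to_subtype
    refine IsCompact.nonempty_iInter_of_directed_nonempty_isCompact_isClosed _ ?_ ?_ ?_ ?_
    · intro ρ ρ'
      rcases le_total (ρ : ℝ) ρ' with h | h
      · exact ⟨ρ, subset_rfl, hmono h⟩
      · exact ⟨ρ', hmono h, subset_rfl⟩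
    · rintro ⟨ρ, x, hx⟩
      exact ⟨toWeakBidual 𝕜 x, toWeakBidual_mem_bidualFarthestBall.2 hx⟩
    · exact fun ρ => isCompact_bidualFarthestBall hBne _
    · exact fun ρ => isClosed_bidualFarthestBall _ _
  obtain ⟨ξ, hξ⟩ := hne
  refine ⟨ξ, mem_bidualFarthestBall.2 fun b hb => le_csInf hRne fun ρ hρ => ?_⟩
  exact mem_bidualFarthestBall.1 (Set.mem_iInter.1 hξ ⟨ρ, hρ⟩) b hb

theorem isBounded_farthestBall {B : Set X} (hB : B.Nonempty) (r : ℝ) :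
    Bornology.IsBounded (farthestBall B r) := by
  obtain ⟨b, hb⟩ := hB
  exact isBounded_closedBall.subset fun x hx => mem_closedBall_iff_norm.2 (hx b hb)

theorem convex_farthestBall [NormedSpace ℝ X] (B : Set X) (r : ℝ) :
    Convex ℝ (farthestBall B r) := by
  have : farthestBall B r = ⋂ b ∈ B, closedBall b r := by
    ext x
    simp [farthestBall, dist_eq_norm]
  rw [this]
  exact convex_iInter₂ fun b _ => convex_closedBall b r

/-- A nonexpansive map `f` with `B ⊆ closure (f '' B)` preserves the Chebyshev center of `B`. -/
theorem mapsTo_farthestBall {f : X → X} (hf : ∀ x y, ‖f x - f y‖ ≤ ‖x - y‖) {B : Set X}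
    (hB : B ⊆ closure (f '' B)) (r : ℝ) :
    Set.MapsTo f (farthestBall B r) (farthestBall B r) := by
  intro x hx b hb
  have hclosed : IsClosed {y | ‖f x - y‖ ≤ r} :=
    isClosed_le (by fun_prop) continuous_const
  refine closure_minimal ?_ hclosed (hB hb)
  rintro _ ⟨b', hb', rfl⟩
  exact (hf x b').trans (hx b' hb')

/-- Compactness of the canonical image in the bidual passes from `𝕜` to `ℝ`. -/
theorem isCompact_toWeakBidual_real [NormedSpace ℝ X] [IsScalarTower ℝ 𝕜 X] {C : Set X}
    (hC : IsCompact (toWeakBidual 𝕜 '' C)) : IsCompact (toWeakBidual ℝ '' C) := by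
  -- A real functional is the real part of its `𝕜`-linear extension, so this map sends evaluation at
  -- `x` to evaluation at `x`.
  let ρ : WeakDual 𝕜 (StrongDual 𝕜 X) → WeakDual ℝ (StrongDual ℝ X) := fun ξ =>
    StrongDual.toWeakDual (RCLike.reCLM.comp
      (((WeakDual.toStrongDual ξ).restrictScalars ℝ).comp
        (StrongDual.extendRCLikeL (𝕜 := 𝕜) (F := X)).toContinuousLinearMap))
  have hρ : Continuous ρ := WeakDual.continuous_of_continuous_eval fun φ =>
    RCLike.continuous_re.comp (WeakDual.eval_continuous (StrongDual.extendRCLike (𝕜 := 𝕜) φ))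
  have h : toWeakBidual ℝ '' C = ρ '' (toWeakBidual 𝕜 '' C) := by
    rw [Set.image_image]
    refine Set.image_congr fun x _ => ?_
    refine DFunLike.ext _ _ fun φ => ?_
    exact (StrongDual.re_extendRCLike_apply (𝕜 := 𝕜) φ x).symm
  exact h ▸ hC.image hρ

end Chebyshev

/-! ### Functionals on the dual represented by points -/

section Representation

variable {X : Type*} [NormedAddCommGroup X] [NormedSpace ℝ X]

/-- Points are separated from weak-* closed convex sets by evaluations. -/
theorem WeakDual.exists_separating_eval {V : Type*} [NormedAddCommGroup V] [NormedSpace ℝ V]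
    {K : Set (WeakDual ℝ V)} (hconv : Convex ℝ K) (hclosed : IsClosed K) {ξ : WeakDual ℝ V}
    (hξ : ξ ∉ K) : ∃ (v : V) (u : ℝ), (∀ η ∈ K, η v < u) ∧ u < ξ v := by
  have : LocallyConvexSpace ℝ (WeakDual ℝ V) :=
    WeakBilin.locallyConvexSpace (B := topDualPairing ℝ V)
  obtain ⟨f, u, hfu, huf⟩ := geometric_hahn_banach_closed_point hconv hclosed hξ
  obtain ⟨v, hv⟩ := LinearMap.dualEmbedding_surjective (topDualPairing ℝ V) f
  have hv' (η : WeakDual ℝ V) : f η = η v := (DFunLike.congr_fun hv η).symm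
  simp only [hv'] at hfu huf
  exact ⟨v, u, hfu, huf⟩

/-- A functional on the dual which is dominated by the oscillation on a weakly compact convex set
is the evaluation at a point. -/
theorem exists_eval_of_le_oscillation {C : Set X} (hconv : Convex ℝ C)
    (hcomp : IsCompact (toWeakBidual ℝ '' C)) (hbdd : Bornology.IsBounded C)
    (F : StrongDual ℝ X →ₗ[ℝ] ℝ) {M : ℝ} (hM : 0 < M)
    (hF : ∀ (ψ : StrongDual ℝ X) (a : ℝ), (∀ x ∈ C, ∀ y ∈ C, ψ x - ψ y ≤ a) → F ψ ≤ M * a) :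
    ∃ z : X, ∀ ψ, F ψ = ψ z := by
  obtain ⟨R, hR⟩ := hbdd.exists_norm_le
  have hle (ψ : StrongDual ℝ X) : F ψ ≤ M * (2 * R) * ‖ψ‖ := by
    have := hF ψ (‖ψ‖ * (R + R)) fun x hx y hy => by
      have h1 : |ψ (x - y)| ≤ ‖ψ‖ * ‖x - y‖ := ψ.le_opNorm (x - y)
      have h2 : ‖x - y‖ ≤ R + R := (norm_sub_le x y).trans (add_le_add (hR x hx) (hR y hy))
      rw [← map_sub]
      exact (le_abs_self _).trans (h1.trans (by gcongr))
    linarith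
  let Fc : StrongDual ℝ (StrongDual ℝ X) := F.mkContinuous (M * (2 * R)) fun ψ => by
    rw [Real.norm_eq_abs, abs_le]
    have h1 := hle ψ
    have h2 := hle (-ψ)
    rw [map_neg, norm_neg] at h2
    exact ⟨by linarith, h1⟩
  let ι : X →ₗ[ℝ] WeakDual ℝ (StrongDual ℝ X) :=
    StrongDual.toWeakDual.toLinearMap ∘ₗ (inclusionInDoubleDual ℝ X).toLinearMap
  let K : Set (WeakDual ℝ (StrongDual ℝ X)) := M • (ι '' C - ι '' C)
  have hKcomp : IsCompact K := by
    have h := (hcomp.prod hcomp).image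
      (f := fun p : WeakDual ℝ (StrongDual ℝ X) × WeakDual ℝ (StrongDual ℝ X) => p.1 - p.2)
      (by fun_prop)
    rw [Set.image_prod (f := fun p q : WeakDual ℝ (StrongDual ℝ X) => p - q), Set.image2_sub] at h
    exact h.image (continuous_const_smul M)
  have hKconv : Convex ℝ K := ((hconv.linear_image ι).sub (hconv.linear_image ι)).smul M
  have hmem : StrongDual.toWeakDual Fc ∈ K := by
    by_contra hnot
    -- The separating `ψ` has oscillation at most `u / M` on `C`, so the hypothesis forces `F ψ ≤
    -- u`.
    obtain ⟨ψ, u, hK, hu⟩ := WeakDual.exists_separating_eval hKconv hKcomp.isClosed hnot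
    have hlt (x y : X) (hx : x ∈ C) (hy : y ∈ C) : M * (ψ x - ψ y) < u :=
      hK _ ⟨_, ⟨_, ⟨x, hx, rfl⟩, _, ⟨y, hy, rfl⟩, rfl⟩, rfl⟩
    have hu' : u < F ψ := hu
    have := hF ψ (u / M) fun x hx y hy => (le_div_iff₀' hM).2 (hlt x y hx hy).le
    rw [mul_div_cancel₀ _ hM.ne'] at this
    linarith
  obtain ⟨_, ⟨_, ⟨x, hx, rfl⟩, _, ⟨y, hy, rfl⟩, rfl⟩, h⟩ := hmem
  refine ⟨M • (x - y), fun ψ => ?_⟩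
  have := congrArg (fun ξ : WeakDual ℝ (StrongDual ℝ X) => ξ ψ) h
  rw [map_smul, map_sub]
  exact this.symm

end Representation

/-! ### Weak continuity of evaluation along a family in `C` -/

section Orbits

variable {S X : Type*} [TopologicalSpace S] [DiscreteTopology S]
  [NormedAddCommGroup X] [NormedSpace ℝ X]

/-- The functions `t ↦ ψ (u t)` on `S`, for a bounded family `u` in `X` and `ψ` in the dual. -/
noncomputable def evalAlong (u : S → X) (R : ℝ) (hu : ∀ t, ‖u t‖ ≤ R) :
    StrongDual ℝ X →ₗ[ℝ] (S →ᵇ ℂ) where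
  toFun ψ := BoundedContinuousFunction.ofNormedAddCommGroupDiscrete (fun t => (ψ (u t) : ℂ))
    (‖ψ‖ * R) fun t => by
      rw [Complex.norm_real]
      exact (ψ.le_opNorm _).trans (mul_le_mul_of_nonneg_left (hu t) (norm_nonneg _))
  map_add' ψ φ := by ext t; simp
  map_smul' c ψ := by ext t; simp

@[simp]
theorem evalAlong_apply (u : S → X) (R : ℝ) (hu : ∀ t, ‖u t‖ ≤ R) (ψ : StrongDual ℝ X) (t : S) :
    evalAlong u R hu ψ t = (ψ (u t) : ℂ) := rfl

variable {C : Set X} {u : S → X} {R : ℝ}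

/-- After subtracting the constant family `x₀`, the sup norm is controlled by the oscillation of `ψ`
on `C`, so `exists_eval_of_le_oscillation` applies; the constant part contributes a multiple of
`x₀`. -/
theorem exists_re_apply_evalAlong (hconv : Convex ℝ C) (hcomp : IsCompact (toWeakBidual ℝ '' C))
    (hC : ∀ x ∈ C, ‖x‖ ≤ R) (hne : C.Nonempty) (huC : ∀ t, u t ∈ C) (μ : StrongDual ℂ (S →ᵇ ℂ)) :
    ∃ z : X, ∀ ψ, (μ (evalAlong u R (fun t => hC _ (huC t)) ψ)).re = ψ z := by
  obtain ⟨x₀, hx₀⟩ := hne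
  let J := evalAlong u R fun t => hC _ (huC t)
  let J₀ := evalAlong (fun _ : S => x₀) R fun _ => hC _ hx₀
  let F : StrongDual ℝ X →ₗ[ℝ] ℝ :=
    Complex.reLm ∘ₗ (μ.toLinearMap.restrictScalars ℝ) ∘ₗ (J - J₀)
  have hF (ψ : StrongDual ℝ X) : F ψ = (μ (J ψ - J₀ ψ)).re := rfl
  obtain ⟨z, hz⟩ := exists_eval_of_le_oscillation hconv hcomp
    ((isBounded_iff_forall_norm_le).2 ⟨R, hC⟩) F (M := ‖μ‖ + 1) (by positivity) fun ψ a ha => by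
      have ha0 : 0 ≤ a := by simpa using ha x₀ hx₀ x₀ hx₀
      have hn : ‖J ψ - J₀ ψ‖ ≤ a := (BoundedContinuousFunction.norm_le ha0).2 fun t => by
        change ‖((ψ (u t) : ℂ) - (ψ x₀ : ℂ))‖ ≤ a
        rw [← Complex.ofReal_sub, Complex.norm_real, Real.norm_eq_abs, abs_le]
        have h1 := ha _ (huC t) _ hx₀
        have h2 := ha _ hx₀ _ (huC t)
        exact ⟨by linarith, h1⟩
      calc F ψ ≤ ‖μ (J ψ - J₀ ψ)‖ := Complex.re_le_norm _
        _ ≤ ‖μ‖ * ‖J ψ - J₀ ψ‖ := μ.le_opNorm _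
        _ ≤ (‖μ‖ + 1) * a := by gcongr; linarith
  refine ⟨z + (μ 1).re • x₀, fun ψ => ?_⟩
  have hJ₀ : J₀ ψ = (ψ x₀ : ℂ) • (1 : S →ᵇ ℂ) := by
    ext t
    simp [J₀]
  have h := hz ψ
  rw [hF, map_sub, hJ₀, map_smul, Complex.sub_re, smul_eq_mul, Complex.re_ofReal_mul] at h
  rw [map_add, map_smul, smul_eq_mul]
  linarith

theorem exists_apply_evalAlong (hconv : Convex ℝ C) (hcomp : IsCompact (toWeakBidual ℝ '' C))
    (hC : ∀ x ∈ C, ‖x‖ ≤ R) (hne : C.Nonempty) (huC : ∀ t, u t ∈ C) (μ : StrongDual ℂ (S →ᵇ ℂ)) :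
    ∃ z w : X, ∀ ψ, μ (evalAlong u R (fun t => hC _ (huC t)) ψ) = ψ z + ψ w * Complex.I := by
  obtain ⟨z, hz⟩ := exists_re_apply_evalAlong hconv hcomp hC hne huC μ
  -- The real part of `-I • μ` is the imaginary part of `μ`.
  obtain ⟨w, hw⟩ := exists_re_apply_evalAlong hconv hcomp hC hne huC (-Complex.I • μ)
  refine ⟨z, w, fun ψ => Complex.ext ?_ ?_⟩
  · simp [hz]
  · simp [← hw]

/-- The map `(ψ, c) ↦ ψ ∘ u + c` is continuous from the weak-* to the weak topology. -/
theorem continuous_evalAlong_add_const (hconv : Convex ℝ C)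
    (hcomp : IsCompact (toWeakBidual ℝ '' C))
    (hC : ∀ x ∈ C, ‖x‖ ≤ R) (hne : C.Nonempty) (huC : ∀ t, u t ∈ C) :
    Continuous fun p : WeakDual ℝ X × ℝ => toWeakSpace ℂ (S →ᵇ ℂ)
      (evalAlong u R (fun t => hC _ (huC t)) (WeakDual.toStrongDual p.1) + (p.2 : ℂ) • 1) := by
  refine WeakBilin.continuous_of_continuous_eval (topDualPairing ℂ (S →ᵇ ℂ)).flip fun μ => ?_
  obtain ⟨z, w, h⟩ := exists_apply_evalAlong hconv hcomp hC hne huC μ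
  have hz (x : X) : Continuous fun p : WeakDual ℝ X × ℝ => ((p.1 x : ℝ) : ℂ) :=
    Complex.continuous_ofReal.comp ((WeakDual.eval_continuous x).comp continuous_fst)
  have hc : Continuous fun p : WeakDual ℝ X × ℝ =>
      ((p.1 z : ℝ) : ℂ) + (p.1 w : ℝ) * Complex.I + (p.2 : ℂ) * μ 1 :=
    ((hz z).add ((hz w).mul continuous_const)).add
      ((Complex.continuous_ofReal.comp continuous_snd).mul continuous_const)
  convert hc using 2 with p
  change μ (_ + _) = _
  rw [map_add, map_smul, h, smul_eq_mul]
  rfl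

end Orbits

/-! ### Linear parts, weak almost periodicity and the fixed point -/

/-- A nonexpansive map preserving real convex combinations is a linear contraction plus a
constant. -/
theorem exists_linear_part {X : Type*} [NormedAddCommGroup X] [NormedSpace ℝ X] {f : X → X}
    (hf : ∀ x y, ‖f x - f y‖ ≤ ‖x - y‖)
    (haff : ∀ (a b : ℝ) (x y : X), 0 ≤ a → 0 ≤ b → a + b = 1 →
      f (a • x + b • y) = a • f x + b • f y) :
    ∃ L : X →L[ℝ] X, ‖L‖ ≤ 1 ∧ ∀ x, f x = L x + f 0 := by
  have hcont : Continuous fun x => f x - f 0 :=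
    (LipschitzWith.of_dist_le_mul (K := 1) fun x y => by
      simpa [dist_eq_norm] using hf x y).continuous.sub continuous_const
  let A : X →+ X := AddMonoidHom.ofMapMidpoint ℝ ℝ (fun x => f x - f 0) (sub_self _) fun x y => by
    have h := haff 2⁻¹ 2⁻¹ x y (by norm_num) (by norm_num) (by norm_num)
    simp only [midpoint_eq_smul_add, invOf_eq_inv, smul_add] at h ⊢
    rw [h, smul_sub, smul_sub]
    have : f 0 = (2⁻¹ : ℝ) • f 0 + (2⁻¹ : ℝ) • f 0 := by rw [← add_smul]; norm_num
    nth_rewrite 1 [this]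
    abel
  refine ⟨A.toRealLinearMap hcont, ContinuousLinearMap.opNorm_le_bound _ zero_le_one fun x => ?_,
    fun x => (sub_add_cancel _ _).symm⟩
  have h := hf x 0
  rw [sub_zero] at h
  rw [one_mul]
  exact h

section FixedPoint

variable {S X : Type*} [Semigroup S] [TopologicalSpace S] [DiscreteTopology S]
  [NormedAddCommGroup X] [NormedSpace ℝ X] {C : Set X} {R : ℝ} {T : S → X → X} {x₀ : X}

theorem leftTranslate_evalAlong (hTR : ∀ t, ‖T t x₀‖ ≤ R)
    (hmul : ∀ s t x, T (s * t) x = T s (T t x)) {s : S} {L : X →L[ℝ] X}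
    (hL : ∀ x, T s x = L x + T s 0) (ψ : StrongDual ℝ X) :
    leftTranslate s (evalAlong (fun t => T t x₀) R hTR ψ) =
      evalAlong (fun t => T t x₀) R hTR (ψ.comp L) + (ψ (T s 0) : ℂ) • 1 := by
  ext t
  simp [hmul, hL (T t x₀)]

theorem isWAP_evalAlong (hconv : Convex ℝ C) (hcomp : IsCompact (toWeakBidual ℝ '' C))
    (hC : ∀ x ∈ C, ‖x‖ ≤ R) (hx₀ : x₀ ∈ C) (hmaps : ∀ s, Set.MapsTo (T s) C C)
    (hmul : ∀ s t x, T (s * t) x = T s (T t x))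
    (hT : ∀ s x y, ‖T s x - T s y‖ ≤ ‖x - y‖)
    (hlin : ∀ s, ∃ L : X →L[ℝ] X, ‖L‖ ≤ 1 ∧ ∀ x, T s x = L x + T s 0) (ψ : StrongDual ℝ X) :
    IsWAP (evalAlong (fun t => T t x₀) R (fun t => hC _ (hmaps t hx₀)) ψ) := by
  -- Compact parameters `(ψ ∘ L, ψ (T s 0))`: `‖L‖ ≤ 1` bounds the first, and comparing `T s 0` with
  -- `T s x₀ ∈ C` bounds the second.
  have hK : IsCompact ((WeakDual.toStrongDual ⁻¹' closedBall (0 : StrongDual ℝ X) ‖ψ‖) ×ˢ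
      Set.Icc (-(‖ψ‖ * (R + R))) (‖ψ‖ * (R + R))) :=
    (WeakDual.isCompact_closedBall _ _).prod isCompact_Icc
  refine IsWAP.of_subset (hK.image (continuous_evalAlong_add_const hconv hcomp hC ⟨x₀, hx₀⟩
    fun t => hmaps t hx₀)) fun s => ?_
  obtain ⟨L, hL1, hL⟩ := hlin s
  refine ⟨(StrongDual.toWeakDual (ψ.comp L), ψ (T s 0)), ⟨?_, ?_⟩, ?_⟩
  · refine mem_closedBall_zero_iff.2 ((ψ.opNorm_comp_le L).trans ?_)
    exact mul_le_of_le_one_right (norm_nonneg _) hL1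
  · rw [Set.mem_Icc, ← abs_le]
    have h1 : ‖T s 0‖ ≤ R + R := by
      have h2 := hT s 0 x₀
      rw [zero_sub, norm_neg] at h2
      calc ‖T s 0‖ = ‖(T s 0 - T s x₀) + T s x₀‖ := by rw [sub_add_cancel]
        _ ≤ ‖T s 0 - T s x₀‖ + ‖T s x₀‖ := norm_add_le _ _
        _ ≤ R + R := add_le_add (h2.trans (hC _ hx₀)) (hC _ (hmaps s hx₀))
    exact (ψ.le_opNorm _).trans (by gcongr)
  · rw [leftTranslate_evalAlong _ hmul hL]
    rfl

/-- Contractive affine semigroup actions with a weakly compact convex invariant set have a common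
fixed point as soon as `WAP(S)` has a left invariant mean. -/
theorem exists_fixedPoint_of_isLeftInvariantMean (hconv : Convex ℝ C)
    (hcomp : IsCompact (toWeakBidual ℝ '' C)) (hC : ∀ x ∈ C, ‖x‖ ≤ R) (hne : C.Nonempty)
    (hmaps : ∀ s, Set.MapsTo (T s) C C)
    (hmul : ∀ s t x, T (s * t) x = T s (T t x))
    (hT : ∀ s x y, ‖T s x - T s y‖ ≤ ‖x - y‖)
    (hlin : ∀ s, ∃ L : X →L[ℝ] X, ‖L‖ ≤ 1 ∧ ∀ x, T s x = L x + T s 0)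
    {m : StrongDual ℂ (WAP S)} (hm : IsLeftInvariantMean m) :
    ∃ z, ∀ s, T s z = z := by
  obtain ⟨x₀, hx₀⟩ := hne
  -- The mean is extended by Hahn–Banach; invariance is used only on `WAP S`.
  obtain ⟨μ, hμ, -⟩ := exists_extension_norm_eq (WAP S) m
  have hμ1 : μ 1 = 1 := (hμ (WAP.one S)).trans hm.map_one
  obtain ⟨z, hz⟩ := exists_re_apply_evalAlong (u := fun t => T t x₀) hconv hcomp hC ⟨x₀, hx₀⟩
    (fun t => hmaps t hx₀) μ
  refine ⟨z, fun s => (SeparatingDual.eq_iff_forall_dual_eq (R := ℝ)).2 fun ψ => ?_⟩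
  obtain ⟨L, -, hL⟩ := hlin s
  have hψ := isWAP_evalAlong hconv hcomp hC hx₀ hmaps hmul hT hlin ψ
  have hinv : μ (leftTranslate s (evalAlong (fun t => T t x₀) R (fun t => hC _ (hmaps t hx₀)) ψ)) =
      μ (evalAlong (fun t => T t x₀) R (fun t => hC _ (hmaps t hx₀)) ψ) :=
    (hμ (WAP.translate s ⟨_, hψ⟩)).trans ((hm.map_translate s ⟨_, hψ⟩).trans (hμ ⟨_, hψ⟩).symm)
  have h := congrArg Complex.re hinv
  rw [leftTranslate_evalAlong _ hmul hL, map_add, map_smul, hμ1, Complex.add_re, hz, hz,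
    smul_eq_mul, mul_one, Complex.ofReal_re] at h
  rw [hL z, map_add]
  exact h

end FixedPoint

theorem theorem2p2 {𝕜 S X : Type*} [RCLike 𝕜]
    [Semigroup S] [TopologicalSpace S] [DiscreteTopology S]
    [NormedAddCommGroup X] [NormedSpace 𝕜 X] [CompleteSpace X]
    (hX : IsLEmbedded 𝕜 X)
    (T : S → X → X) (hT : IsNonexpansiveAffineRep 𝕜 T)
    (hLIM : ∃ m : StrongDual ℂ (WAP S), IsLeftInvariantMean m)
    (B : Set X) (hBne : B.Nonempty) (hBbdd : Bornology.IsBounded B)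
    (hB : ∀ s : S, B ⊆ closure (T s '' B)) :
    ∃ x : X, ∀ s : S, T s x = x := by
  obtain ⟨m, hm⟩ := hLIM
  let _ : NormedSpace ℝ X := NormedSpace.restrictScalars ℝ 𝕜 X
  have htower : IsScalarTower ℝ 𝕜 X := IsScalarTower.of_algebraMap_smul fun _ _ => rfl
  obtain ⟨r, hne, hcomp⟩ := hX.exists_chebyshev_center hBne hBbdd
  obtain ⟨R, hR⟩ := (isBounded_farthestBall hBne r).exists_norm_le
  refine exists_fixedPoint_of_isLeftInvariantMean (convex_farthestBall B r)
    (isCompact_toWeakBidual_real hcomp) hR hne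
    (fun s => mapsTo_farthestBall (hT.nonexpansive s) (hB s) r) hT.map_mul hT.nonexpansive
    (fun s => exists_linear_part (hT.nonexpansive s) ?_) hm
  exact hT.affine s
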